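/- Let $C$ be a differentiable simple closed curve of finite total length $L$ in the complex plane $z=x+iy$, with an arc-length parametrization $\lambda\mapsto c(\lambda)$ (so $c$ is differentiable, $L$-periodic, injective on $[0,L)$, and $|c'|=1$). Let $\gamma$ be an invertible conformal transformation from the closed unit disk to the union of $C$ and its interior, mapping the unit circle bijectively onto $C$ and the open disk bijectively onto the interior of $C$; $\gamma$ is complex differentiable on the closed disk, and its derivative is continuous and has no zeros there. Let $f$ be a real function on $C$ that is locally integrable almost everywhere on $C$: there is a finite set $E\subset C$ such that $f$ is integrable with respect to arc length on every closed interval of $C$ that contains no point of $E$ (the case of an $f$ integrable on all of $C$ is included). Let $f_a(\theta)=f(\gamma(e^{i\theta}))$ be the function transferred to the unit circle, and let $w$ be an inner analytic function corresponding to $f_a$. By this we mean the following. For a function $F$ integrable on the circle, with Fourier coefficients $\alpha_k=\frac1\pi\int_0^{2\pi}F\cos k\theta\,d\theta$ and $\beta_k=\frac1\pi\int_0^{2\pi}F\sin k\theta\,d\theta$, its inner analytic function is $\sum_{k\ge 0}c_kz^k$ on $|z|<1$, with $c_0=\alpha_0/2$ and $c_k=\alpha_k-i\beta_k$ for $k\ge1$.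 A function $w$ on the open unit disk corresponds to $f_a$ if, for some $n\ge 0$, some $n$-th piecewise primitive $F$ of $f_a$ (a $2\pi$-periodic function obtained by integrating $n$ times in $\theta$ on the arcs of the circle that avoid the points $\gamma^{-1}(E)$, with arbitrary constants of integration on each arc) is integrable on the circle, and $w$ is the $n$-th angular derivative of the inner analytic function of $F$, the angular derivative of $v$ being $iz\,v'(z)$. (For $n=0$, $w$ is the inner analytic function of an integrable $f_a$.) A point $\zeta$ of the unit circle is a hard singularity of $w$ if $w(z)$ has no finite limit as $z\to\zeta$, $|z|<1$, and is called soft otherwise. The angular primitive of $w$ is $-i\int_0^z\frac{w(z')-w(0)}{z'}\,dz'$. A hard singularity that becomes soft after one angular integration is borderline hard, and a hard singularity has finite degree of hardness $m\ge0$ if $m$ angular integrations make it borderline hard. Suppose that $w$ has finitely many hard singularities on the unit circle, and that each of them has a finite degree of hardness. Then the Dirichlet problem for $f$ in the interior of $C$ has a solution: there is a real function $u(x,y)$ that is harmonic ($\nabla^2u=0$) in the interior of $C$ and assumes the values $f$ almost everywhere on $C$, in the sense that $u(z)\to f(\zeta)$ as $z\to\zeta$ from within the interior, for almost every $\zeta\in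 C$ with respect to arc length. -/

import Mathlib

open Set Filter Topology MeasureTheory

noncomputable section

namespace Dirichlet

/-! ### Curves, conformal maps, boundary data -/

/-- `c` is an arc-length parametrization, of period `L` (the total length), of a differentiable
simple closed curve in the plane. The curve itself is `range c`. -/
structure IsSimpleClosedCurve (c : ℝ → ℂ) (L : ℝ) : Prop where
  length_pos : 0 < L
  periodic : Function.Periodic c L
  injOn : InjOn c (Ico 0 L)
  differentiable : Differentiable ℝ c
  unit_speed : ∀ s, ‖deriv c s‖ = 1

/-- The interior of a closed curve with image `C`: the union of the bounded connected components
of its complement. -/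
def curveInterior (C : Set ℂ) : Set ℂ :=
  {z | z ∉ C ∧ Bornology.IsBounded (connectedComponentIn Cᶜ z)}

/-- `γ` is an invertible conformal transformation from the closed unit disk to the union of the
closed curve `C` and its interior, mapping the unit circle to `C`. It is (complex) differentiable
on the closed disk, with a continuous derivative that has no zeros there. -/
structure IsConformalMap (γ : ℂ → ℂ) (C : Set ℂ) : Prop where
  bijOn_circle : BijOn γ (Metric.sphere 0 1) C
  bijOn_disk : BijOn γ (Metric.ball 0 1) (curveInterior C)
  exists_deriv : ∃ γ' : ℂ → ℂ, ContinuousOn γ' (Metric.closedBall 0 1) ∧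
    ∀ z ∈ Metric.closedBall (0 : ℂ) 1,
      HasDerivWithinAt γ (γ' z) (Metric.closedBall 0 1) z ∧ γ' z ≠ 0

/-- The real function `f` on the curve parametrized by `c` is locally integrable almost everywhere,
with `E` as its finite set of exceptional points: it is integrable with respect to arc length
on every closed interval of the curve that contains no point of `E`. -/
structure IsLocallyIntegrableOff (c : ℝ → ℂ) (f : ℂ → ℝ) (E : Set ℂ) : Prop where
  finite : E.Finite
  subset : E ⊆ range c
  integrableOn : ∀ a b : ℝ, (∀ s ∈ Icc a b, c s ∉ E) →
    IntegrableOn (fun s => f (c s)) (Icc a b)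

/-- The point of the unit circle at angle `θ`. -/
def circlePoint (θ : ℝ) : ℂ := Complex.exp (θ * Complex.I)

/-! ### Inner analytic functions -/

/-- The angular derivative `i z w'(z)`. -/
def angularDeriv (w : ℂ → ℂ) : ℂ → ℂ := fun z => Complex.I * z * deriv w z

/-- The angular primitive `-i ∫_0^z (w(z') - w(0)) / z' dz'`, the integral being taken along
the segment `z' = t z`, `0 ≤ t ≤ 1`. -/
def angularPrimitive (w : ℂ → ℂ) : ℂ → ℂ := fun z =>
  -Complex.I * ∫ t in (0 : ℝ)..1, (w (t * z) - w 0) / t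

/-- `w` is soft at the point `ζ` of the unit circle: it has a finite limit at `ζ` from within
the open unit disk. -/
def IsSoftAt (w : ℂ → ℂ) (ζ : ℂ) : Prop :=
  ∃ l : ℂ, Tendsto w (𝓝[Metric.ball 0 1] ζ) (𝓝 l)

/-- The hard singularities of `w` on the unit circle. -/
def hardSingularities (w : ℂ → ℂ) : Set ℂ :=
  {ζ | ζ ∈ Metric.sphere (0 : ℂ) 1 ∧ ¬ IsSoftAt w ζ}

/-- A borderline hard singularity: a hard one that a single angular integration makes soft. -/
def IsBorderlineHardAt (w : ℂ → ℂ) (ζ : ℂ) : Prop :=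
  ¬ IsSoftAt w ζ ∧ IsSoftAt (angularPrimitive w) ζ

/-- The degree of hardness at `ζ` is `m`: after `m` angular integrations the singularity is
borderline hard. -/
def HasDegreeOfHardness (w : ℂ → ℂ) (ζ : ℂ) (m : ℕ) : Prop :=
  IsBorderlineHardAt (angularPrimitive^[m] w) ζ

/-! ### The inner analytic function of a real function on the unit circle -/

/-- The Fourier coefficient `α_k`. -/
def fourierCos (F : ℝ → ℝ) (k : ℕ) : ℝ :=
  (1 / Real.pi) * ∫ θ in (0 : ℝ)..(2 * Real.pi), F θ * Real.cos (k * θ)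

/-- The Fourier coefficient `β_k`. -/
def fourierSin (F : ℝ → ℝ) (k : ℕ) : ℝ :=
  (1 / Real.pi) * ∫ θ in (0 : ℝ)..(2 * Real.pi), F θ * Real.sin (k * θ)

/-- The Taylor coefficients `c_0 = α_0 / 2` and `c_k = α_k - i β_k` for `k ≥ 1`. -/
def taylorCoeff (F : ℝ → ℝ) (k : ℕ) : ℂ :=
  if k = 0 then ((fourierCos F 0 / 2 : ℝ) : ℂ)
  else (fourierCos F k : ℂ) - Complex.I * (fourierSin F k : ℂ)

/-- The inner analytic function `∑ c_k z^k` of an integrable real function on the circle. -/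
def innerAnalytic (F : ℝ → ℝ) : ℂ → ℂ := fun z => ∑' k : ℕ, taylorCoeff F k * z ^ k

/-- `G` is a piecewise primitive of `g`, both being functions of the angle on the unit circle:
on every closed interval that contains no point of `A` it is a primitive of `g`
(with a free integration constant on each of the arcs into which `A` divides the circle). -/
def IsPiecewisePrimitive (A : Set ℂ) (g G : ℝ → ℝ) : Prop :=
  Function.Periodic G (2 * Real.pi) ∧
    ∀ a b : ℝ, a ≤ b → (∀ θ ∈ Icc a b, circlePoint θ ∉ A) → G b - G a = ∫ θ in a..b, g θ

/-- `w` is an inner analytic function corresponding to the real function `g` of the angle on the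
unit circle, which may be non-integrable at the points of the finite set `A`: for some `n`,
some `n`-th piecewise primitive of `g` is integrable on the whole circle, and, on the open
unit disk, `w` is the `n`-th angular derivative of the inner analytic function of that primitive.
For `n = 0` this is the inner analytic function of an integrable `g`. -/
def IsCorrespondingInnerAnalytic (A : Set ℂ) (g : ℝ → ℝ) (w : ℂ → ℂ) : Prop :=
  ∃ (n : ℕ) (P : ℕ → ℝ → ℝ), P 0 = g ∧
    (∀ k < n, IsPiecewisePrimitive A (P k) (P (k + 1))) ∧
    IntervalIntegrable (P n) volume 0 (2 * Real.pi) ∧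
    EqOn w (angularDeriv^[n] (innerAnalytic (P n))) (Metric.ball 0 1)

/-! ### The Dirichlet problem -/

/-- `u` solves the Dirichlet problem in the interior of the curve parametrized by arc length by
`c`, with boundary values `f`: it is harmonic in the interior, and at almost every point of the
curve it has the limit prescribed by `f`, from within the interior. -/
def SolvesDirichlet (c : ℝ → ℂ) (f : ℂ → ℝ) (u : ℂ → ℝ) : Prop :=
  InnerProductSpace.HarmonicOnNhd u (curveInterior (range c)) ∧
    ∀ᵐ s : ℝ, Tendsto u (𝓝[curveInterior (range c)] (c s)) (𝓝 (f (c s)))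

end Dirichlet

end

/-! The solution is the real part of `w` composed with the inverse of `γ`. Both are holomorphic, so
harmonicity is immediate; the work is in the boundary values. At a soft point `w` has a limit by
definition, so `w` extends continuously to the closed disk minus finitely many points. It remains to
see that the real part of this extension is the transferred data almost everywhere, and this is done
by duality. Let `φ` be a smooth function supported in an arc free of hard singularities and of
exceptional points. On the circle of radius `r < 1` the angular derivative is `d/dθ`, so `n`
integrations by parts move the derivatives from the inner analytic function of `P n` to `φ`. As `r →
1`, real parts of inner analytic functions converge weakly to their integrable data
(`tendsto_integral_re_innerAnalytic_mul`). Then `n` further integrations by parts, where the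
piecewise integration constants vanish, return from `P n` to the data. Uniqueness of limits gives
`integral_boundaryExtension_mul_eq`, and the fundamental lemma of the calculus of variations turns
it into equality almost everywhere. Two transfers between arc length and angle complete the
argument: local integrability passes to the circle (`eventually_integrable_angle`) and null sets
pass back to the curve (`volume_setOf_angle_mem_eq_zero`). The second must cope with `c` being
merely differentiable. -/

noncomputable section

namespace Dirichlet

/-! ### Fourier series of twice differentiable functions -/

/-- The `n`-th complex Fourier coefficient of a function on `[0, 2π]`. -/
def expCoeff (ψ : ℝ → ℂ) (n : ℤ) : ℂ :=
  1 / (2 * Real.pi) * ∫ x in (0 : ℝ)..(2 * Real.pi), Complex.exp (-(n * x * Complex.I)) * ψ x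

theorem exp_neg_int_mul_two_pi (n : ℤ) :
    Complex.exp (-(n * ((2 * Real.pi : ℝ) : ℂ) * Complex.I)) = 1 := by
  rw [Complex.exp_eq_one_iff]
  exact ⟨-n, by push_cast; ring⟩

theorem norm_exp_neg_int_mul (n : ℤ) (x : ℝ) :
    ‖Complex.exp (-(n * x * Complex.I))‖ = 1 := by
  have : -((n : ℂ) * x * Complex.I) = ((-(n * x) : ℝ) : ℂ) * Complex.I := by push_cast; ring
  rw [this, Complex.norm_exp_ofReal_mul_I]

theorem expCoeff_deriv {ψ : ℝ → ℂ} (hψ : ContDiff ℝ 1 ψ) (h : ψ 0 = ψ (2 * Real.pi)) (n : ℤ) :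
    expCoeff (deriv ψ) n = n * Complex.I * expCoeff ψ n := by
  have hd : ∀ x : ℝ, HasDerivAt (fun x : ℝ => Complex.exp (-(n * x * Complex.I)))
      (-(n * Complex.I) * Complex.exp (-(n * x * Complex.I))) x := by
    intro x
    have h1 : HasDerivAt (fun x : ℝ => -((n : ℂ) * x * Complex.I)) (-(n * Complex.I)) x := by
      refine HasDerivAt.fun_neg ?_
      have := (((hasDerivAt_id (x : ℂ)).comp_ofReal).const_mul (n : ℂ)).mul_const Complex.I
      simpa using this
    have := h1.cexp
    rwa [mul_comm] at this
  have hc : Continuous (deriv ψ) := hψ.continuous_deriv le_rfl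
  have := intervalIntegral.integral_mul_deriv_eq_deriv_mul (a := 0) (b := 2 * Real.pi)
    (u := fun x : ℝ => Complex.exp (-(n * x * Complex.I))) (v := ψ) (v' := deriv ψ)
    (fun x _ => hd x)
    (fun x _ => ((hψ.differentiable one_ne_zero) x).hasDerivAt)
    (Continuous.intervalIntegrable (by fun_prop) _ _)
    (hc.intervalIntegrable _ _)
  rw [expCoeff, this, expCoeff, exp_neg_int_mul_two_pi]
  have h2 : ∀ x : ℝ, -((n : ℂ) * Complex.I) * Complex.exp (-(n * x * Complex.I)) * ψ x =
      -((n : ℂ) * Complex.I) * (Complex.exp (-(n * x * Complex.I)) * ψ x) := fun x => by ring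
  simp only [h2, intervalIntegral.integral_const_mul, h]
  simp
  ring

theorem norm_expCoeff_le {ψ : ℝ → ℂ} {M : ℝ} (hM : ∀ x ∈ Icc (0 : ℝ) (2 * Real.pi), ‖ψ x‖ ≤ M)
    (n : ℤ) : ‖expCoeff ψ n‖ ≤ M := by
  have h := intervalIntegral.norm_integral_le_of_norm_le_const (a := 0) (b := 2 * Real.pi)
    (f := fun x : ℝ => Complex.exp (-(n * x * Complex.I)) * ψ x) (C := M) (by
      intro x hx
      rw [uIoc_of_le Real.two_pi_pos.le] at hx
      rw [norm_mul, norm_exp_neg_int_mul, one_mul]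
      exact hM x (Ioc_subset_Icc_self hx))
  rw [sub_zero, abs_of_pos Real.two_pi_pos] at h
  rw [expCoeff, norm_mul]
  have h1 : ‖(1 / (2 * Real.pi) : ℂ)‖ = 1 / (2 * Real.pi) := by
    rw [norm_div, norm_mul]; simp [abs_of_pos Real.pi_pos]
  rw [h1, one_div, inv_mul_le_iff₀ Real.two_pi_pos]
  exact h.trans_eq (mul_comm _ _)

/-- The coefficients of the second derivative are bounded and equal `-n ^ 2` times those of `ψ`; the
endpoint conditions cancel the boundary terms. -/
theorem summable_norm_expCoeff {ψ : ℝ → ℂ} (hψ : ContDiff ℝ 2 ψ) (h : ψ 0 = ψ (2 * Real.pi))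
    (h' : deriv ψ 0 = deriv ψ (2 * Real.pi)) : Summable fun n => ‖expCoeff ψ n‖ := by
  have hd : ContDiff ℝ 1 (deriv ψ) :=
    (contDiff_succ_iff_deriv (n := 1) (f := ψ)).1 hψ |>.2.2
  have hdd : Continuous (deriv (deriv ψ)) := hd.continuous_deriv le_rfl
  obtain ⟨M, hM⟩ := (isCompact_Icc (a := (0 : ℝ)) (b := 2 * Real.pi)).exists_bound_of_continuousOn
    hdd.continuousOn
  have key : ∀ n : ℤ, ‖expCoeff (deriv (deriv ψ)) n‖ = (n : ℝ) ^ 2 * ‖expCoeff ψ n‖ := by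
    intro n
    rw [expCoeff_deriv hd h', expCoeff_deriv (hψ.of_le (by norm_num)) h]
    simp only [norm_mul, Complex.norm_I, Complex.norm_intCast]
    rw [← sq_abs]; ring
  refine Summable.of_norm_bounded_eventually (g := fun n : ℤ => M * (1 / (n : ℝ) ^ 2))
    ((Real.summable_one_div_int_pow.2 one_lt_two).mul_left M) ?_
  refine (Set.finite_singleton (0 : ℤ)).subset fun n hn => ?_
  by_contra h0
  apply hn
  have h0 : (n : ℝ) ≠ 0 := by exact_mod_cast h0
  have h1 := norm_expCoeff_le hM n
  rw [key] at h1
  change ‖‖expCoeff ψ n‖‖ ≤ _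
  rw [norm_norm, mul_one_div, le_div_iff₀ (by positivity)]
  linarith

theorem hasSum_expCoeff {ψ : ℝ → ℂ} (hψ : Continuous ψ) (h : ψ 0 = ψ (2 * Real.pi))
    (hs : Summable fun n => ‖expCoeff ψ n‖) {x : ℝ} (hx : x ∈ Ico 0 (2 * Real.pi)) :
    HasSum (fun n : ℤ => expCoeff ψ n * Complex.exp (n * x * Complex.I)) (ψ x) := by
  have : Fact (0 < 2 * Real.pi) := ⟨Real.two_pi_pos⟩
  let g : C(AddCircle (2 * Real.pi), ℂ) := ⟨AddCircle.liftIco (2 * Real.pi) 0 ψ,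
    AddCircle.liftIco_continuous (by simpa using h) hψ.continuousOn⟩
  have hg : ∀ n, fourierCoeff g n = expCoeff ψ n := by
    intro n
    change fourierCoeff (AddCircle.liftIco (2 * Real.pi) 0 ψ) n = _
    rw [fourierCoeff_liftIco_eq, fourierCoeffOn_eq_integral, expCoeff]
    have : ∀ t : ℝ, (fourier (-n) : C(AddCircle (0 + 2 * Real.pi - 0), ℂ)) (t : AddCircle _) =
        Complex.exp (-(n * t * Complex.I)) := by
      intro t
      rw [fourier_coe_apply]
      congr 1
      have : (Real.pi : ℂ) ≠ 0 := by exact_mod_cast Real.pi_ne_zero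
      push_cast
      field_simp
      ring
    simp only [this, smul_eq_mul, zero_add, sub_zero]
    rw [Complex.real_smul]
    push_cast
    rfl
  have hsum : Summable (fourierCoeff g) := by
    rw [show fourierCoeff (g : AddCircle (2 * Real.pi) → ℂ) = expCoeff ψ from funext hg]
    exact hs.of_norm
  have := has_pointwise_sum_fourier_series_of_summable hsum (x : AddCircle (2 * Real.pi))
  have h2 : g (x : AddCircle (2 * Real.pi)) = ψ x :=
    AddCircle.liftIco_coe_apply (by simpa using hx)
  rw [h2] at this
  convert this using 2 with n
  rw [hg, smul_eq_mul, fourier_coe_apply]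
  congr 2
  have : (Real.pi : ℂ) ≠ 0 := by exact_mod_cast Real.pi_ne_zero
  push_cast
  field_simp

theorem conj_expCoeff_ofReal (ψ : ℝ → ℝ) (n : ℤ) :
    (starRingEnd ℂ) (expCoeff (fun x => (ψ x : ℂ)) n) = expCoeff (fun x => (ψ x : ℂ)) (-n) := by
  rw [expCoeff, expCoeff, map_mul, intervalIntegral.integral_of_le Real.two_pi_pos.le,
    intervalIntegral.integral_of_le Real.two_pi_pos.le, ← integral_conj]
  congr 1
  · simp [Complex.conj_ofNat]
  · refine integral_congr_ae (ae_of_all _ fun x => ?_)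
    simp [← Complex.exp_conj]

/-! ### The Poisson integral in the weak sense -/

theorem _root_.IntervalIntegrable.complex_ofReal {F : ℝ → ℝ} {μ : Measure ℝ} {a b : ℝ}
    (hF : IntervalIntegrable F μ a b) : IntervalIntegrable (fun x => (F x : ℂ)) μ a b :=
  ⟨hF.1.ofReal, hF.2.ofReal⟩

/-- The factor 2 for `k ≥ 1` stands for the negative frequencies, which for real `F` are recovered
by taking the real part of the power series. -/
theorem taylorCoeff_eq_expCoeff {F : ℝ → ℝ} (hF : IntervalIntegrable F volume 0 (2 * Real.pi))
    (k : ℕ) : taylorCoeff F k = (if k = 0 then 1 else 2) * expCoeff (fun x => (F x : ℂ)) k := by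
  have hcos : IntervalIntegrable (fun θ => F θ * Real.cos (k * θ)) volume 0 (2 * Real.pi) :=
    hF.mul_continuousOn (by fun_prop)
  have hsin : IntervalIntegrable (fun θ => F θ * Real.sin (k * θ)) volume 0 (2 * Real.pi) :=
    hF.mul_continuousOn (by fun_prop)
  have h : ∫ x in (0 : ℝ)..(2 * Real.pi), Complex.exp (-(((k : ℤ) : ℂ) * x * Complex.I)) * (F x : ℂ)
      = ((∫ θ in (0 : ℝ)..(2 * Real.pi), F θ * Real.cos (k * θ) : ℝ) : ℂ) -
        Complex.I * ((∫ θ in (0 : ℝ)..(2 * Real.pi), F θ * Real.sin (k * θ) : ℝ) : ℂ) := by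
    rw [← intervalIntegral.integral_ofReal, ← intervalIntegral.integral_ofReal,
      ← intervalIntegral.integral_const_mul, ← intervalIntegral.integral_sub hcos.complex_ofReal
        (hsin.complex_ofReal.const_mul _)]
    refine intervalIntegral.integral_congr fun x _ => ?_
    have : -(((k : ℤ) : ℂ) * x * Complex.I) = ((-(k * x) : ℝ) : ℂ) * Complex.I := by
      push_cast; ring
    simp only [this, Complex.exp_mul_I, ← Complex.ofReal_cos, ← Complex.ofReal_sin, Real.cos_neg,
      Real.sin_neg]
    push_cast
    ring
  have hπ : (Real.pi : ℂ) ≠ 0 := by exact_mod_cast Real.pi_ne_zero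
  rw [expCoeff, h, taylorCoeff, fourierCos, fourierCos, fourierSin]
  split_ifs with h0
  · subst h0
    simp
    field_simp
  · push_cast
    field_simp

theorem exists_norm_taylorCoeff_le {F : ℝ → ℝ}
    (hF : IntervalIntegrable F volume 0 (2 * Real.pi)) :
    ∃ M, ∀ k, ‖taylorCoeff F k‖ ≤ M := by
  refine ⟨2 * (‖(1 / (2 * Real.pi) : ℂ)‖ * ∫ x in (0 : ℝ)..(2 * Real.pi), ‖F x‖), fun k => ?_⟩
  rw [taylorCoeff_eq_expCoeff hF, norm_mul, expCoeff, norm_mul]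
  gcongr
  · split_ifs <;> simp
  · refine (intervalIntegral.norm_integral_le_integral_norm Real.two_pi_pos.le).trans_eq ?_
    refine intervalIntegral.integral_congr fun x _ => ?_
    change ‖Complex.exp (-(((k : ℤ) : ℂ) * x * Complex.I)) * (F x : ℂ)‖ = _
    rw [norm_mul, norm_exp_neg_int_mul, one_mul, Complex.norm_real]

theorem differentiableOn_innerAnalytic {F : ℝ → ℝ}
    (hF : IntervalIntegrable F volume 0 (2 * Real.pi)) :
    DifferentiableOn ℂ (innerAnalytic F) (Metric.ball 0 1) := by
  obtain ⟨M, hM⟩ := exists_norm_taylorCoeff_le hF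
  intro z hz
  rw [mem_ball_zero_iff] at hz
  -- The coefficients are only bounded, so the Weierstrass test needs a smaller disk of radius `ρ <
  -- 1`.
  obtain ⟨ρ, hzρ, hρ⟩ := exists_between hz
  have hρ0 : 0 ≤ ρ := (norm_nonneg z).trans hzρ.le
  have h : DifferentiableOn ℂ (innerAnalytic F) (Metric.ball 0 ρ) := by
    refine Complex.differentiableOn_tsum_of_summable_norm (u := fun k => M * ρ ^ k)
      ((summable_geometric_of_lt_one hρ0 hρ).mul_left M) (fun k => by fun_prop)
      Metric.isOpen_ball fun k w hw => ?_
    rw [mem_ball_zero_iff] at hw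
    rw [norm_mul, norm_pow]
    gcongr
    · exact (norm_nonneg _).trans (hM 0)
    · exact hM k
  exact (h.differentiableAt (Metric.isOpen_ball.mem_nhds (by simpa using hzρ)))
    |>.differentiableWithinAt

theorem norm_circlePoint (θ : ℝ) : ‖circlePoint θ‖ = 1 := Complex.norm_exp_ofReal_mul_I θ

theorem continuous_circlePoint : Continuous circlePoint := by
  unfold circlePoint; fun_prop

theorem integral_innerAnalytic_mul {F : ℝ → ℝ}
    (hF : IntervalIntegrable F volume 0 (2 * Real.pi)) {ψ : ℝ → ℂ} (hψ : Continuous ψ)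
    {r : ℝ} (hr0 : 0 ≤ r) (hr : r < 1) :
    ∫ θ in (0 : ℝ)..(2 * Real.pi), innerAnalytic F (r * circlePoint θ) * ψ θ =
      ∑' k : ℕ, taylorCoeff F k * r ^ k * (2 * Real.pi * expCoeff ψ (-k)) := by
  obtain ⟨M, hM⟩ := exists_norm_taylorCoeff_le hF
  have hM0 : 0 ≤ M := (norm_nonneg _).trans (hM 0)
  obtain ⟨K, hK⟩ := (isCompact_Icc (a := (0 : ℝ)) (b := 2 * Real.pi)).exists_bound_of_continuousOn
    hψ.continuousOn
  have hs : Summable fun k : ℕ => M * r ^ k * K :=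
    ((summable_geometric_of_lt_one hr0 hr).mul_left M).mul_right K
  have hb : ∀ (k : ℕ) (θ : ℝ), ‖taylorCoeff F k * (r * circlePoint θ) ^ k‖ ≤ M * r ^ k := by
    intro k θ
    rw [norm_mul, norm_pow, norm_mul, norm_circlePoint, mul_one, Complex.norm_real,
      Real.norm_of_nonneg hr0]
    gcongr
    exact hM k
  have key := intervalIntegral.hasSum_integral_of_dominated_convergence (μ := volume)
    (a := 0) (b := 2 * Real.pi)
    (F := fun (k : ℕ) (θ : ℝ) => taylorCoeff F k * (r * circlePoint θ) ^ k * ψ θ)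
    (f := fun θ => innerAnalytic F (r * circlePoint θ) * ψ θ)
    (fun k _ => M * r ^ k * K) ?_ ?_ ?_ ?_ ?_
  · rw [← key.tsum_eq]
    refine tsum_congr fun k => ?_
    have hπ : (Real.pi : ℂ) ≠ 0 := by exact_mod_cast Real.pi_ne_zero
    have h2 : 2 * (Real.pi : ℂ) * expCoeff ψ (-k) =
        ∫ x in (0 : ℝ)..(2 * Real.pi), circlePoint x ^ k * ψ x := by
      rw [expCoeff, ← mul_assoc, mul_one_div_cancel (by simp), one_mul]
      refine intervalIntegral.integral_congr fun x _ => ?_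
      simp only [circlePoint, ← Complex.exp_nat_mul]
      congr 2
      push_cast
      ring
    rw [h2, ← intervalIntegral.integral_const_mul]
    refine intervalIntegral.integral_congr fun x _ => ?_
    simp only [mul_pow]
    ring
  · intro k
    refine Continuous.aestronglyMeasurable ?_
    have := continuous_circlePoint
    fun_prop
  · intro k
    refine ae_of_all _ fun θ hθ => ?_
    rw [uIoc_of_le Real.two_pi_pos.le] at hθ
    rw [norm_mul]
    gcongr
    · exact hb k θ
    · exact hK θ (Ioc_subset_Icc_self hθ)
  · exact ae_of_all _ fun _ _ => hs
  · exact intervalIntegrable_const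
  · refine ae_of_all _ fun θ _ => HasSum.mul_right _ ?_
    refine Summable.hasSum (Summable.of_norm_bounded
      ((summable_geometric_of_lt_one hr0 hr).mul_left M) (hb · θ))

/-- A Parseval identity, the `r = 1` counterpart of `integral_innerAnalytic_mul`. Since `ψ` is real,
it is the real part of a one-sided series `S`. That series converges absolutely, so `F * S` can be
integrated termwise although `F` is merely integrable. -/
theorem integral_mul_eq_re_tsum {F : ℝ → ℝ}
    (hF : IntervalIntegrable F volume 0 (2 * Real.pi)) {ψ : ℝ → ℝ} (hψ : Continuous ψ)
    (h : ψ 0 = ψ (2 * Real.pi)) (hs : Summable fun n => ‖expCoeff (fun x => (ψ x : ℂ)) n‖) :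
    ∫ θ in (0 : ℝ)..(2 * Real.pi), F θ * ψ θ =
      (∑' k : ℕ, taylorCoeff F k * (2 * Real.pi * expCoeff (fun x => (ψ x : ℂ)) (-k))).re := by
  set a := expCoeff (fun x => (ψ x : ℂ)) with ha
  let ε : ℕ → ℂ := fun k => if k = 0 then 1 else 2
  have hε : ∀ k, ‖ε k‖ ≤ 2 := fun k => by
    simp only [ε]; split_ifs <;> simp
  have hs' : Summable fun k : ℕ => 2 * ‖a (-k)‖ := by
    refine Summable.mul_left _ ?_
    exact hs.comp_injective (i := fun k : ℕ => (-k : ℤ)) (fun i j hij => by simpa using hij)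
  have hnorm : ∀ (k : ℕ) (t : ℝ),
      ‖ε k * a (-k) * Complex.exp (-(((k : ℤ) : ℂ) * t * Complex.I))‖ ≤ 2 * ‖a (-k)‖ := by
    intro k t
    rw [norm_mul, norm_mul, norm_exp_neg_int_mul, mul_one]
    gcongr
    exact hε k
  let S : ℝ → ℂ := fun t =>
    ∑' k : ℕ, ε k * a (-k) * Complex.exp (-(((k : ℤ) : ℂ) * t * Complex.I))
  have hS : ∀ t : ℝ, HasSum
      (fun k : ℕ => ε k * a (-k) * Complex.exp (-(((k : ℤ) : ℂ) * t * Complex.I))) (S t) :=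
    fun t => (Summable.of_norm_bounded hs' (hnorm · t)).hasSum
  have hSre : ∀ t ∈ Ico 0 (2 * Real.pi), (S t).re = ψ t := by
    intro t ht
    have h1 := (hasSum_expCoeff (by fun_prop) (by simp [h]) hs ht).nat_add_neg
    -- Folding the sum over `ℤ` onto `ℕ` counts frequency 0 twice; one copy is removed.
    have h2 := h1.sub (hasSum_ite_eq (0 : ℕ) (a 0))
    have h3 := (Complex.hasSum_re h2)
    refine (Complex.hasSum_re (hS t)).unique ?_
    convert h3 using 1
    · ext k
      rcases eq_or_ne k 0 with rfl | hk
      · simp [ε, ← ha]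
      · have h4 : a (k : ℤ) * Complex.exp (((k : ℤ) : ℂ) * t * Complex.I) =
            (starRingEnd ℂ) (a (-k) * Complex.exp (-(((k : ℤ) : ℂ) * t * Complex.I))) := by
          rw [map_mul, ha, conj_expCoeff_ofReal, neg_neg, ← Complex.exp_conj]
          simp
        simp only [ε, hk, if_false]
        rw [← ha, h4]
        simp
        ring
    · simp [← ha]
  have key := intervalIntegral.hasSum_integral_of_dominated_convergence (μ := volume)
    (a := 0) (b := 2 * Real.pi)
    (F := fun (k : ℕ) (t : ℝ) =>
      (F t : ℂ) * (ε k * a (-k) * Complex.exp (-(((k : ℤ) : ℂ) * t * Complex.I))))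
    (f := fun t => (F t : ℂ) * S t)
    (fun k t => ‖F t‖ * (2 * ‖a (-k)‖)) ?_ ?_ ?_ ?_ ?_
  · have h5 : (∑' k : ℕ, taylorCoeff F k * (2 * Real.pi * a (-k))) =
        ∫ t in (0 : ℝ)..(2 * Real.pi), (F t : ℂ) * S t := by
      rw [← key.tsum_eq]
      refine tsum_congr fun k => ?_
      have hπ : (Real.pi : ℂ) ≠ 0 := by exact_mod_cast Real.pi_ne_zero
      rw [taylorCoeff_eq_expCoeff hF, expCoeff]
      rw [show ∀ x y z w : ℂ, x * (1 / (2 * w) * y) * (2 * w * z) = x * z * y * (w / w) by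
        intros; field_simp, div_self hπ, mul_one, ← intervalIntegral.integral_const_mul]
      refine intervalIntegral.integral_congr fun x _ => ?_
      simp only [ε]
      ring
    have hint : IntervalIntegrable (fun t => (F t : ℂ) * S t) volume 0 (2 * Real.pi) := by
      refine hF.complex_ofReal.mul_continuousOn (Continuous.continuousOn ?_)
      exact continuous_tsum (fun k => by fun_prop) hs' hnorm
    rw [h5]
    have h6 := Complex.reCLM.intervalIntegral_comp_comm hint
    simp only [Complex.reCLM_apply] at h6
    rw [← h6]
    -- The Fourier expansion of `ψ` is known only on the half-open interval containing 0, hence the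
    -- passage from `Ioc` to `Ico`.
    rw [intervalIntegral.integral_of_le Real.two_pi_pos.le,
      intervalIntegral.integral_of_le Real.two_pi_pos.le, ← integral_Ico_eq_integral_Ioc,
      ← integral_Ico_eq_integral_Ioc]
    refine setIntegral_congr_fun measurableSet_Ico fun t ht => ?_
    simp [hSre t ht]
  · intro k
    rw [uIoc_of_le Real.two_pi_pos.le]
    have := ((intervalIntegrable_iff_integrableOn_Ioc_of_le Real.two_pi_pos.le).1
      hF.complex_ofReal).aestronglyMeasurable 
    exact this.mul (Continuous.aestronglyMeasurable (by fun_prop))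
  · intro k
    refine ae_of_all _ fun t _ => ?_
    rw [norm_mul, Complex.norm_real]
    gcongr
    exact hnorm k t
  · exact ae_of_all _ fun t _ => hs'.mul_left _
  · simp only [tsum_mul_left]
    exact hF.norm.mul_const _
  · exact ae_of_all _ fun t _ => (hS t).mul_left _

/-- Abel summation: the factors `r ^ k ≤ 1` leave the summable bound from the coefficients of `ψ`
intact, so the limit may be taken term by term. No pointwise convergence to `F` is needed. -/
theorem tendsto_integral_re_innerAnalytic_mul {F : ℝ → ℝ}
    (hF : IntervalIntegrable F volume 0 (2 * Real.pi)) {ψ : ℝ → ℝ} (hψ : ContDiff ℝ 2 ψ)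
    (h : ψ 0 = ψ (2 * Real.pi)) (h' : deriv ψ 0 = deriv ψ (2 * Real.pi)) :
    Tendsto (fun r : ℝ => ∫ θ in (0 : ℝ)..(2 * Real.pi),
        (innerAnalytic F (r * circlePoint θ)).re * ψ θ) (𝓝[<] 1)
      (𝓝 (∫ θ in (0 : ℝ)..(2 * Real.pi), F θ * ψ θ)) := by
  have hdc : ∀ x, deriv (fun x => (ψ x : ℂ)) x = ((deriv ψ x : ℝ) : ℂ) := fun x =>
    ((hψ.differentiable two_ne_zero x).hasDerivAt.ofReal_comp).deriv
  have hs : Summable fun n => ‖expCoeff (fun x => (ψ x : ℂ)) n‖ :=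
    summable_norm_expCoeff (Complex.ofRealCLM.contDiff.comp hψ) (by simp [h])
      (by rw [hdc, hdc, h'])
  obtain ⟨M, hM⟩ := exists_norm_taylorCoeff_le hF
  rw [integral_mul_eq_re_tsum hF hψ.continuous h hs]
  have hIoo : ∀ᶠ r : ℝ in 𝓝[<] 1, r ∈ Ioo (0 : ℝ) 1 := Ioo_mem_nhdsLT one_pos
  have hlim : Tendsto (fun r : ℝ => ∑' k : ℕ, taylorCoeff F k * r ^ k *
        (2 * Real.pi * expCoeff (fun x => (ψ x : ℂ)) (-k))) (𝓝[<] 1)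
      (𝓝 (∑' k : ℕ, taylorCoeff F k * (2 * Real.pi * expCoeff (fun x => (ψ x : ℂ)) (-k)))) := by
    refine tendsto_tsum_of_dominated_convergence
      (bound := fun k : ℕ => M * (2 * Real.pi * ‖expCoeff (fun x => (ψ x : ℂ)) (-k)‖)) ?_ ?_ ?_
    · refine ((hs.comp_injective (i := fun k : ℕ => (-k : ℤ))
        (fun i j hij => by simpa using hij)).mul_left _).mul_left _
    · intro k
      have : Continuous fun r : ℝ => taylorCoeff F k * (r : ℂ) ^ k *
          (2 * Real.pi * expCoeff (fun x => (ψ x : ℂ)) (-k)) := by fun_prop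
      have := (this.tendsto 1).mono_left (nhdsWithin_le_nhds (s := Iio 1))
      simpa using this
    · filter_upwards [hIoo] with r hr k
      rw [norm_mul, norm_mul, norm_mul, norm_pow, Complex.norm_real, Real.norm_of_nonneg hr.1.le]
      have h1 : ‖(2 * Real.pi : ℂ)‖ = 2 * Real.pi := by
        rw [norm_mul]; simp [abs_of_pos Real.pi_pos]
      rw [h1]
      have h2 : r ^ k ≤ 1 := pow_le_one₀ hr.1.le hr.2.le
      have h3 : ‖taylorCoeff F k‖ * r ^ k ≤ M := by
        have := mul_le_mul (hM k) h2 (pow_nonneg hr.1.le k) ((norm_nonneg _).trans (hM k))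
        simpa using this
      gcongr
  refine ((Complex.continuous_re.tendsto _).comp hlim).congr' ?_
  filter_upwards [hIoo] with r hr
  rw [Function.comp_apply, ← integral_innerAnalytic_mul hF (by fun_prop) hr.1.le hr.2]
  have hc : Continuous fun θ => innerAnalytic F (r * circlePoint θ) := by
    refine (differentiableOn_innerAnalytic hF).continuousOn.comp_continuous
      (continuous_const.mul continuous_circlePoint) fun θ => ?_
    rw [mem_ball_zero_iff, norm_mul, norm_circlePoint, mul_one, Complex.norm_real,
      Real.norm_of_nonneg hr.1.le]
    exact hr.2
  have h6 := Complex.reCLM.intervalIntegral_comp_comm (μ := volume) (a := 0) (b := 2 * Real.pi)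
    (f := fun θ => innerAnalytic F (r * circlePoint θ) * (ψ θ : ℂ))
    (Continuous.intervalIntegrable (by fun_prop) _ _)
  simp only [Complex.reCLM_apply] at h6
  rw [← h6]
  refine intervalIntegral.integral_congr fun t _ => ?_
  simp

/-! ### Inverses of conformal maps of the closed disk -/

/-- The inverse pulls a closed set back to the image of a compact set, which is closed in a
Hausdorff space. -/
theorem _root_.IsCompact.continuousOn_invFunOn {X Y : Type*} [TopologicalSpace X]
    [TopologicalSpace Y] [T2Space Y] [Nonempty X] {f : X → Y} {K : Set X} (hK : IsCompact K)
    (hf : ContinuousOn f K) (hinj : InjOn f K) :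
    ContinuousOn (Function.invFunOn f K) (f '' K) := by
  rw [continuousOn_iff_isClosed]
  intro t ht
  refine ⟨f '' (K ∩ t), ((hK.inter_right ht).image_of_continuousOn
    (hf.mono inter_subset_left)).isClosed, ?_⟩
  ext y
  constructor
  · rintro ⟨hy, x, hx, rfl⟩
    rw [mem_preimage, hinj.leftInvOn_invFunOn hx] at hy
    exact ⟨⟨x, ⟨hx, hy⟩, rfl⟩, x, hx, rfl⟩
  · rintro ⟨⟨x, ⟨hx, hxt⟩, rfl⟩, -⟩
    refine ⟨?_, x, hx, rfl⟩
    rwa [mem_preimage, hinj.leftInvOn_invFunOn hx]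

variable {γ : ℂ → ℂ} {C : Set ℂ}

theorem IsConformalMap.continuousOn (hγ : IsConformalMap γ C) :
    ContinuousOn γ (Metric.closedBall 0 1) := by
  obtain ⟨γ', -, h⟩ := hγ.exists_deriv
  exact fun z hz => (h z hz).1.continuousWithinAt

theorem IsConformalMap.injOn (hγ : IsConformalMap γ C) : InjOn γ (Metric.closedBall 0 1) := by
  rw [← Metric.ball_union_sphere, injOn_union (by
    rw [disjoint_left]; intro z hz hz'
    exact (Metric.mem_ball.1 hz).ne (Metric.mem_sphere.1 hz'))]
  refine ⟨hγ.bijOn_disk.injOn, hγ.bijOn_circle.injOn, fun z hz z' hz' h => ?_⟩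
  exact (hγ.bijOn_disk.mapsTo hz).1 (h ▸ hγ.bijOn_circle.mapsTo hz')

/-- The inverse of a conformal map of the closed disk. -/
def diskInverse (γ : ℂ → ℂ) : ℂ → ℂ := Function.invFunOn γ (Metric.closedBall 0 1)

theorem IsConformalMap.diskInverse_apply (hγ : IsConformalMap γ C) {z : ℂ}
    (hz : z ∈ Metric.closedBall (0 : ℂ) 1) : diskInverse γ (γ z) = z :=
  hγ.injOn.leftInvOn_invFunOn hz

theorem IsConformalMap.continuousOn_diskInverse (hγ : IsConformalMap γ C) :
    ContinuousOn (diskInverse γ) (C ∪ curveInterior C) := by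
  have := (isCompact_closedBall (0 : ℂ) 1).continuousOn_invFunOn hγ.continuousOn hγ.injOn
  rwa [← Metric.sphere_union_ball, image_union, hγ.bijOn_circle.image_eq,
    hγ.bijOn_disk.image_eq, Metric.sphere_union_ball] at this

theorem IsConformalMap.mapsTo_diskInverse_curve (hγ : IsConformalMap γ C) :
    MapsTo (diskInverse γ) C (Metric.sphere 0 1) := by
  intro z hz
  obtain ⟨x, hx, rfl⟩ := hγ.bijOn_circle.surjOn hz
  rwa [hγ.diskInverse_apply (Metric.sphere_subset_closedBall hx)]

theorem IsConformalMap.mapsTo_diskInverse_interior (hγ : IsConformalMap γ C) :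
    MapsTo (diskInverse γ) (curveInterior C) (Metric.ball 0 1) := by
  intro z hz
  obtain ⟨x, hx, rfl⟩ := hγ.bijOn_disk.surjOn hz
  rwa [hγ.diskInverse_apply (Metric.ball_subset_closedBall hx)]

theorem IsConformalMap.apply_diskInverse (hγ : IsConformalMap γ C) {z : ℂ}
    (hz : z ∈ C ∪ curveInterior C) : γ (diskInverse γ z) = z := by
  rcases hz with hz | hz
  · obtain ⟨x, hx, rfl⟩ := hγ.bijOn_circle.surjOn hz
    rw [hγ.diskInverse_apply (Metric.sphere_subset_closedBall hx)]
  · obtain ⟨x, hx, rfl⟩ := hγ.bijOn_disk.surjOn hz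
    rw [hγ.diskInverse_apply (Metric.ball_subset_closedBall hx)]

theorem IsConformalMap.hasDerivAt_of_mem_ball (hγ : IsConformalMap γ C) {z : ℂ}
    (hz : z ∈ Metric.ball (0 : ℂ) 1) : ∃ d ≠ 0, HasDerivAt γ d z := by
  obtain ⟨γ', -, h⟩ := hγ.exists_deriv
  have := h z (Metric.ball_subset_closedBall hz)
  exact ⟨γ' z, this.2, this.1.hasDerivAt
    (mem_of_superset (Metric.isOpen_ball.mem_nhds hz) Metric.ball_subset_closedBall)⟩

/-- Components of an open set are open, and all points of one component share the same boundedness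
condition. -/
theorem isOpen_curveInterior (hC : IsClosed C) : IsOpen (curveInterior C) := by
  rw [isOpen_iff_mem_nhds]
  rintro z ⟨hz, hb⟩
  have ho : IsOpen (connectedComponentIn Cᶜ z) := hC.isOpen_compl.connectedComponentIn
  filter_upwards [ho.mem_nhds (mem_connectedComponentIn hz)] with y hy
  refine ⟨connectedComponentIn_subset _ _ hy, ?_⟩
  rwa [← connectedComponentIn_eq hy]

theorem IsConformalMap.isClosed (hγ : IsConformalMap γ C) : IsClosed C := by
  rw [← hγ.bijOn_circle.image_eq]
  exact ((isCompact_sphere (0 : ℂ) 1).image_of_continuousOn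
    (hγ.continuousOn.mono Metric.sphere_subset_closedBall)).isClosed

theorem IsConformalMap.differentiableOn_diskInverse (hγ : IsConformalMap γ C) :
    DifferentiableOn ℂ (diskInverse γ) (curveInterior C) := by
  intro z hz
  have hnhds := (isOpen_curveInterior hγ.isClosed).mem_nhds hz
  obtain ⟨d, hd, h⟩ := hγ.hasDerivAt_of_mem_ball (hγ.mapsTo_diskInverse_interior hz)
  refine (HasDerivAt.of_local_left_inverse (f := γ) ?_ h hd ?_).differentiableAt
    |>.differentiableWithinAt
  · exact (hγ.continuousOn_diskInverse.mono subset_union_right).continuousAt hnhds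
  · filter_upwards [hnhds] with y hy
    exact hγ.apply_diskInverse (Or.inr hy)

/-! ### The boundary parametrized by the angle -/

theorem circlePoint_mem_sphere (θ : ℝ) : circlePoint θ ∈ Metric.sphere (0 : ℂ) 1 := by
  simp [norm_circlePoint]

theorem circlePoint_mem_closedBall (θ : ℝ) : circlePoint θ ∈ Metric.closedBall (0 : ℂ) 1 :=
  Metric.sphere_subset_closedBall (circlePoint_mem_sphere θ)

theorem hasDerivAt_circlePoint (θ : ℝ) :
    HasDerivAt circlePoint (Complex.I * circlePoint θ) θ := by
  have h : HasDerivAt (fun x : ℝ => (x : ℂ) * Complex.I) Complex.I θ := by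
    simpa using ((hasDerivAt_id (θ : ℂ)).comp_ofReal).mul_const Complex.I
  have := h.cexp
  rwa [mul_comm] at this

theorem periodic_circlePoint : Function.Periodic circlePoint (2 * Real.pi) := by
  intro θ
  rw [circlePoint, circlePoint]
  push_cast
  rw [add_mul, Complex.exp_add, Complex.exp_two_pi_mul_I, mul_one]

theorem exists_circlePoint_eq {z : ℂ} (hz : z ∈ Metric.sphere (0 : ℂ) 1) :
    ∃ θ ∈ Ico 0 (2 * Real.pi), circlePoint θ = z := by
  refine ⟨toIcoMod Real.two_pi_pos 0 (Complex.arg z), ?_, ?_⟩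
  · simpa using toIcoMod_mem_Ico Real.two_pi_pos 0 (Complex.arg z)
  · rw [toIcoMod, periodic_circlePoint.sub_zsmul_eq]
    have h := Complex.norm_mul_exp_arg_mul_I z
    rwa [mem_sphere_zero_iff_norm.1 hz, Complex.ofReal_one, one_mul] at h

theorem IsConformalMap.exists_hasDerivAt_circlePoint (hγ : IsConformalMap γ C) :
    ∃ g' : ℝ → ℂ, Continuous g' ∧ (∃ K : NNReal, ∀ θ, ‖g' θ‖₊ ≤ K) ∧ ∀ θ, g' θ ≠ 0 ∧
      HasDerivAt (fun θ => γ (circlePoint θ)) (g' θ) θ := by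
  obtain ⟨γ', hc, h⟩ := hγ.exists_deriv
  refine ⟨fun θ => (Complex.I * circlePoint θ) * γ' (circlePoint θ), ?_, ?_, fun θ => ⟨?_, ?_⟩⟩
  · exact (continuous_const.mul continuous_circlePoint).mul
      (hc.comp_continuous continuous_circlePoint circlePoint_mem_closedBall)
  · obtain ⟨K, hK⟩ := (isCompact_closedBall (0 : ℂ) 1).exists_bound_of_continuousOn hc
    refine ⟨K.toNNReal, fun θ => ?_⟩
    rw [← NNReal.coe_le_coe, coe_nnnorm, norm_mul, norm_mul, Complex.norm_I, norm_circlePoint,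
      one_mul, one_mul]
    exact (hK _ (circlePoint_mem_closedBall θ)).trans (Real.le_coe_toNNReal K)
  · have h1 : circlePoint θ ≠ 0 := Complex.exp_ne_zero _
    exact mul_ne_zero (mul_ne_zero Complex.I_ne_zero h1) (h _ (circlePoint_mem_closedBall θ)).2
  · exact (h _ (circlePoint_mem_closedBall θ)).1.scomp_hasDerivAt θ (hasDerivAt_circlePoint θ)
      circlePoint_mem_closedBall

/-- The difference quotient of `c` is that of `g` times that of `θ`, and the former can be divided
out in the limit because `g' ≠ 0`. Using `dslope` covers the points where `θ s = θ t`. The limit is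
real because the slopes of `θ` are. -/
theorem hasDerivAt_of_comp_eq {g c : ℝ → ℂ} {θ : ℝ → ℝ} {g' c' : ℂ} {t : ℝ}
    (hg : HasDerivAt g g' (θ t)) (hg' : g' ≠ 0) (hc : HasDerivAt c c' t) (hθ : ContinuousAt θ t)
    (h : ∀ s, g (θ s) = c s) : ∃ d : ℝ, (d : ℂ) = c' / g' ∧ HasDerivAt θ d t := by
  have hD : Tendsto (fun s => dslope g (θ t) (θ s)) (𝓝[≠] t) (𝓝 g') := by
    have h1 : ContinuousAt (dslope g (θ t)) (θ t) := continuousAt_dslope_same.2 hg.differentiableAt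
    have h2 := h1.tendsto.comp hθ.tendsto
    rw [dslope_same, hg.deriv] at h2
    exact h2.mono_left nhdsWithin_le_nhds
  have hlim : Tendsto (fun s => ((slope θ t s : ℝ) : ℂ)) (𝓝[≠] t) (𝓝 (c' / g')) := by
    refine ((hasDerivAt_iff_tendsto_slope.1 hc).div hD hg').congr' ?_
    filter_upwards [hD.eventually_ne hg'] with s hs
    have h3 := sub_smul_dslope g (θ t) (θ s)
    rw [h, h] at h3
    rw [Pi.div_apply, slope_def_module, ← h3, slope_def_field, div_eq_iff hs]
    simp only [Complex.real_smul]
    push_cast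
    ring
  have hre := (Complex.continuous_re.tendsto _).comp hlim
  have him := (Complex.continuous_im.tendsto _).comp hlim
  have h0 : (c' / g').im = 0 := by
    refine tendsto_nhds_unique him ?_
    simp [Function.comp_def]
  refine ⟨(c' / g').re, Complex.ext (by simp) (by simp [h0]), ?_⟩
  rw [hasDerivAt_iff_tendsto_slope]
  simpa [Function.comp_def] using hre

variable {c : ℝ → ℂ} {L : ℝ} {f : ℂ → ℝ} {E : Set ℂ}

theorem IsSimpleClosedCurve.eq_of_abs_sub_lt (hc : IsSimpleClosedCurve c L) {s t : ℝ}
    (h : c s = c t) (hst : |s - t| < L) : s = t := by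
  have hL := hc.length_pos
  have hmod : ∀ x, c (toIcoMod hL 0 x) = c x := fun x => by
    rw [toIcoMod, hc.periodic.sub_zsmul_eq]
  have hmem : ∀ x, toIcoMod hL 0 x ∈ Ico 0 L := fun x => by
    simpa using toIcoMod_mem_Ico hL 0 x
  obtain ⟨n, hn⟩ := (toIcoMod_eq_toIcoMod hL).1
    (hc.injOn (hmem s) (hmem t) (by rw [hmod, hmod, h]))
  rw [abs_sub_comm, hn, zsmul_eq_mul, abs_mul, abs_of_pos hL] at hst
  have h1 : |(n : ℝ)| < 1 := by
    by_contra! h2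
    nlinarith
  have h2 : n = 0 := Int.abs_lt_one_iff.1 (by exact_mod_cast h1)
  rw [h2, zero_smul] at hn
  linarith

/-- Near the given point the angle is an injective differentiable function of arc length with `|θ'|
= 1 / ‖g'‖`. The change of variables formula then applies without continuity of `c'`. -/
theorem eventually_integrable_angle (hc : IsSimpleClosedCurve c L)
    (hγ : IsConformalMap γ (range c)) (hf : IsLocallyIntegrableOff c f E) {θ₀ : ℝ}
    (hθ₀ : γ (circlePoint θ₀) ∉ E) :
    IntegrableAtFilter (fun θ => f (γ (circlePoint θ))) (𝓝 θ₀) := by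
  obtain ⟨t₀, ht₀⟩ : γ (circlePoint θ₀) ∈ range c :=
    hγ.bijOn_circle.mapsTo (circlePoint_mem_sphere θ₀)
  set ζ : ℝ → ℂ := fun t => diskInverse γ (c t) with hζ
  have hcc : Continuous c := hc.differentiable.continuous
  have hζc : Continuous ζ := (hγ.continuousOn_diskInverse.mono subset_union_left).comp_continuous
    hcc fun t => mem_range_self t
  have hζn : ∀ t, ‖ζ t‖ = 1 := fun t => by
    simpa using hγ.mapsTo_diskInverse_curve (mem_range_self (f := c) t)
  have hζγ : ∀ t, γ (ζ t) = c t := fun t => hγ.apply_diskInverse (Or.inl (mem_range_self t))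
  have hζ0 : circlePoint θ₀ = ζ t₀ := by
    rw [hζ]; simp only [ht₀]
    rw [hγ.diskInverse_apply (circlePoint_mem_closedBall θ₀)]
  have hne : ∀ t, ζ t ≠ 0 := fun t h => by simpa [h] using hζn t
  -- Dividing by `ζ t₀` places the branch cut of `arg` opposite the base point.
  let θ : ℝ → ℝ := fun t => θ₀ + Complex.arg (ζ t / ζ t₀)
  have hθ : ∀ t, circlePoint (θ t) = ζ t := by
    intro t
    have h1 := Complex.norm_mul_exp_arg_mul_I (ζ t / ζ t₀)
    rw [norm_div, hζn, hζn, div_one, Complex.ofReal_one, one_mul] at h1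
    simp only [θ, circlePoint]
    push_cast
    rw [add_mul, Complex.exp_add, h1, show Complex.exp (θ₀ * Complex.I) = ζ t₀ from hζ0,
      mul_div_cancel₀ _ (hne t₀)]
  have hθ00 : θ t₀ = θ₀ := by simp [θ, div_self (hne t₀)]
  have hslit : ∀ᶠ t in 𝓝 t₀, ζ t / ζ t₀ ∈ Complex.slitPlane := by
    have : Continuous fun t => ζ t / ζ t₀ := hζc.div_const _
    refine this.continuousAt.eventually_mem (Complex.isOpen_slitPlane.mem_nhds ?_)
    rw [div_self (hne t₀)]
    exact Complex.one_mem_slitPlane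
  have hEo : ∀ᶠ t in 𝓝 t₀, c t ∉ E :=
    hcc.continuousAt.eventually_mem (hf.finite.isClosed.isOpen_compl.mem_nhds (by rwa [ht₀]))
  obtain ⟨δ, hδ, hball⟩ := Metric.eventually_nhds_iff_ball.1 (hslit.and hEo)
  -- `δ / 2` keeps the interval inside the good neighbourhood; `L / 3` keeps its length below one
  -- period, so that `c` is injective there.
  set η := min (δ / 2) (L / 3) with hη
  have hη0 : 0 < η := lt_min (by linarith) (by linarith [hc.length_pos])
  set p := t₀ - η
  set q := t₀ + η
  have hpq : p < q := by simp only [p, q]; linarith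
  have hJ : ∀ t ∈ Icc p q, ζ t / ζ t₀ ∈ Complex.slitPlane ∧ c t ∉ E := by
    intro t ht
    refine hball t ?_
    have : η ≤ δ / 2 := min_le_left _ _
    rw [Metric.mem_ball, Real.dist_eq, abs_lt]
    simp only [p, q, mem_Icc] at ht
    constructor <;> linarith
  have hθc : ∀ t ∈ Icc p q, ContinuousAt θ t := fun t ht =>
    continuousAt_const.add ((Complex.continuousAt_arg (hJ t ht).1).comp
      (f := fun t => ζ t / ζ t₀) (hζc.div_const _).continuousAt)
  have hinj : InjOn θ (Icc p q) := by
    intro s hs t ht hst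
    have h1 : c s = c t := by rw [← hζγ, ← hζγ, ← hθ, ← hθ, hst]
    refine hc.eq_of_abs_sub_lt h1 ?_
    have : η ≤ L / 3 := min_le_right _ _
    have := hc.length_pos
    simp only [p, q, mem_Icc] at hs ht
    rw [abs_lt]
    constructor <;> linarith
  obtain ⟨g', hg'c, -, hg'⟩ := hγ.exists_hasDerivAt_circlePoint
  have hder : ∀ t ∈ Icc p q, ∃ d : ℝ, (d : ℂ) = deriv c t / g' (θ t) ∧ HasDerivAt θ d t :=
    fun t ht => hasDerivAt_of_comp_eq (hg' (θ t)).2 (hg' (θ t)).1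
      (hc.differentiable t).hasDerivAt (hθc t ht) fun s => by rw [hθ, hζγ]
  choose! d hd hθd using hder
  have hint : IntegrableOn (fun θ => f (γ (circlePoint θ))) (θ '' Icc p q) := by
    rw [integrableOn_image_iff_integrableOn_abs_deriv_smul measurableSet_Icc
      (fun t ht => (hθd t ht).hasDerivWithinAt) hinj]
    have h1 : IntegrableOn (fun t => ‖g' (θ t)‖⁻¹ * f (c t)) (Icc p q) := by
      refine (hf.integrableOn p q fun t ht => (hJ t ht).2).continuousOn_mul ?_ isCompact_Icc
      refine ContinuousOn.inv₀ ?_ fun t _ => norm_ne_zero_iff.2 (hg' _).1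
      exact (hg'c.comp_continuousOn fun t ht => (hθc t ht).continuousWithinAt).norm
    refine h1.congr_fun (fun t ht => ?_) measurableSet_Icc
    have h2 : |d t| = ‖g' (θ t)‖⁻¹ := by
      have := congrArg norm (hd t ht)
      rwa [Complex.norm_real, norm_div, hc.unit_speed, one_div] at this
    simp only [smul_eq_mul, h2, hθ, hζγ]
  refine ⟨θ '' Icc p q, ?_, hint⟩
  have hcont : ContinuousOn θ (Icc p q) := fun t ht => (hθc t ht).continuousWithinAt
  have hp : p ∈ Icc p q := left_mem_Icc.2 hpq.le
  have hq : q ∈ Icc p q := right_mem_Icc.2 hpq.le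
  have h0 : t₀ ∈ Icc p q := by simp only [p, q, mem_Icc]; constructor <;> linarith
  have hp0 : p < t₀ := by simp only [p]; linarith
  have h0q : t₀ < q := by simp only [q]; linarith
  -- The two cases are the two orientations of `c` relative to `γ`; in each the image contains a
  -- neighbourhood of `θ₀`.
  rcases hcont.strictMonoOn_of_injOn_Icc' hpq.le hinj with hm | hm
  · refine mem_of_superset (Icc_mem_nhds (hθ00 ▸ hm hp h0 hp0) (hθ00 ▸ hm h0 hq h0q)) ?_
    exact intermediate_value_Icc hpq.le hcont
  · refine mem_of_superset (Icc_mem_nhds (hθ00 ▸ hm h0 hq h0q) (hθ00 ▸ hm hp h0 hp0)) ?_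
    exact intermediate_value_Icc' hpq.le hcont

theorem integrableOn_angle (hc : IsSimpleClosedCurve c L) (hγ : IsConformalMap γ (range c))
    (hf : IsLocallyIntegrableOff c f E) {K : Set ℝ} (hK : IsCompact K)
    (h : ∀ θ ∈ K, γ (circlePoint θ) ∉ E) :
    IntegrableOn (fun θ => f (γ (circlePoint θ))) K :=
  LocallyIntegrableOn.integrableOn_isCompact (fun θ hθ =>
    (eventually_integrable_angle hc hγ hf (h θ hθ)).filter_mono nhdsWithin_le_nhds) hK

/-! ### Null sets on the curve -/

/-- A nonzero derivative bounds `|t - s|` by a multiple of `‖c t - c s‖` near each `s`, but not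
uniformly in `s`. The sets `A n k` make it uniform: `n` fixes both constant and radius, and the
floor confines the set to an interval of length `1 / (n + 1)`. On each set `c` has a Lipschitz
inverse, which preserves null sets, and there are countably many. -/
theorem volume_preimage_eq_zero_of_hausdorffMeasure {c c' : ℝ → ℂ}
    (hc : ∀ s, HasDerivAt c (c' s) s) (hc' : ∀ s, c' s ≠ 0) {Z : Set ℂ}
    (hZ : Measure.hausdorffMeasure 1 Z = 0) : volume (c ⁻¹' Z) = 0 := by
  let A : ℕ → ℤ → Set ℝ := fun n k => {s | c s ∈ Z ∧ ⌊s * (n + 1)⌋ = k ∧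
    ∀ t, |t - s| * (n + 1) < 1 → ‖t - s‖ ≤ (n + 1) * ‖c t - c s‖}
  have hcover : c ⁻¹' Z ⊆ ⋃ n, ⋃ k, A n k := by
    intro s hs
    obtain ⟨K, hK⟩ := ((hc s).isTheta_sub (hc' s)).2.bound
    rw [prod_pure, eventually_map] at hK
    obtain ⟨δ, hδ, hball⟩ := Metric.eventually_nhds_iff_ball.1 hK
    obtain ⟨n, hn⟩ := exists_nat_ge (max K (1 / δ))
    simp only [mem_iUnion]
    refine ⟨n, _, hs, rfl, fun t ht => ?_⟩
    have h1 : 1 / δ ≤ n := (le_max_right _ _).trans hn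
    have h2 : 1 ≤ n * δ := (div_le_iff₀ hδ).1 h1
    refine (hball t ?_).trans ?_
    · rw [Metric.mem_ball, Real.dist_eq]
      by_contra! h3
      nlinarith [abs_nonneg (t - s), Nat.cast_nonneg (α := ℝ) n]
    · gcongr
      linarith [(le_max_left K (1 / δ)).trans hn]
  refine measure_mono_null hcover (measure_iUnion_null fun n => measure_iUnion_null fun k => ?_)
  have hA : ∀ s ∈ A n k, ∀ t ∈ A n k, ‖t - s‖ ≤ (n + 1) * ‖c t - c s‖ := by
    intro s hs t ht
    refine hs.2.2 t ?_
    have h1 := Int.abs_sub_lt_one_of_floor_eq_floor (ht.2.1.trans hs.2.1.symm)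
    rwa [← sub_mul, abs_mul, abs_of_nonneg (by positivity : (0 : ℝ) ≤ n + 1)] at h1
  have hinj : InjOn c (A n k) := by
    intro s hs t ht h
    have := hA s hs t ht
    rw [h, sub_self, norm_zero, mul_zero] at this
    exact (sub_eq_zero.1 (norm_le_zero_iff.1 this)).symm
  have hlip : LipschitzOnWith (n + 1) (Function.invFunOn c (A n k)) (c '' A n k) := by
    refine LipschitzOnWith.of_dist_le_mul ?_
    rintro _ ⟨s, hs, rfl⟩ _ ⟨t, ht, rfl⟩
    rw [hinj.leftInvOn_invFunOn hs, hinj.leftInvOn_invFunOn ht, dist_eq_norm, dist_eq_norm]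
    exact_mod_cast hA t ht s hs
  have h0 : Measure.hausdorffMeasure 1 (c '' A n k) = 0 :=
    measure_mono_null (image_subset_iff.2 fun s hs => hs.1) hZ
  have h1 := hlip.hausdorffMeasure_image_le zero_le_one
  rw [hinj.leftInvOn_invFunOn.image_image, h0, mul_zero, hausdorffMeasure_real] at h1
  exact le_antisymm h1 zero_le

theorem volume_setOf_angle_mem_eq_zero (hc : IsSimpleClosedCurve c L)
    (hγ : IsConformalMap γ (range c)) {N : Set ℝ} (hN : volume N = 0) :
    volume {s | ∃ θ ∈ N, γ (circlePoint θ) = c s} = 0 := by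
  obtain ⟨g', -, ⟨K, hK⟩, hg'⟩ := hγ.exists_hasDerivAt_circlePoint
  have hlip : LipschitzWith K fun θ => γ (circlePoint θ) :=
    lipschitzWith_of_nnnorm_deriv_le (fun θ => (hg' θ).2.differentiableAt)
      fun θ => by rw [(hg' θ).2.deriv]; exact hK θ
  refine volume_preimage_eq_zero_of_hausdorffMeasure
    (Z := (fun θ => γ (circlePoint θ)) '' N) (fun s => (hc.differentiable s).hasDerivAt)
    (fun s h => by simpa [h] using hc.unit_speed s) ?_
  refine le_antisymm ((hlip.hausdorffMeasure_image_le zero_le_one N).trans_eq ?_) zero_le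
  rw [hausdorffMeasure_real, hN, mul_zero]

/-! ### Iterated integration by parts -/

/-- Since `g` is only integrable, its primitive is differentiated almost everywhere and parts are
taken for absolutely continuous functions. The constant `G a` drops out because `φ'` has integral
zero. -/
theorem integral_mul_deriv_of_primitive {G g φ : ℝ → ℝ} {a b : ℝ} (hab : a ≤ b)
    (hg : IntervalIntegrable g volume a b)
    (hG : ∀ x ∈ Icc a b, G x - G a = ∫ t in a..x, g t) (hφ : ContDiff ℝ 1 φ)
    (ha : φ a = 0) (hb : φ b = 0) :
    ∫ x in a..b, G x * deriv φ x = -∫ x in a..b, g x * φ x := by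
  have hac : AbsolutelyContinuousOnInterval (fun x => ∫ t in a..x, g t) a b :=
    hg.absolutelyContinuousOnInterval_intervalIntegral left_mem_uIcc
  have hφac : AbsolutelyContinuousOnInterval φ a b :=
    hφ.contDiffOn.absolutelyContinuousOnInterval
  have h1 := hac.integral_mul_deriv_eq_deriv_mul hφac
  rw [ha, hb, mul_zero, mul_zero, sub_zero, zero_sub] at h1
  have h2 : ∫ x in a..b, deriv (fun x => ∫ t in a..x, g t) x * φ x = ∫ x in a..b, g x * φ x := by
    refine intervalIntegral.integral_congr_ae ?_
    filter_upwards [hg.ae_hasDerivAt_integral] with x hx hxI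
    rw [(hx (uIoc_subset_uIcc hxI) a left_mem_uIcc).deriv]
  have hφ' : IntervalIntegrable (deriv φ) volume a b :=
    (hφ.continuous_deriv le_rfl).intervalIntegrable _ _
  have h3 : ∫ x in a..b, G x * deriv φ x =
      ∫ x in a..b, ((∫ t in a..x, g t) * deriv φ x + G a * deriv φ x) := by
    refine intervalIntegral.integral_congr fun x hx => ?_
    rw [uIcc_of_le hab] at hx
    simp only [← hG x hx]
    ring
  have h4 : ∫ x in a..b, deriv φ x = 0 := by
    rw [intervalIntegral.integral_deriv_eq_sub
      (fun x _ => hφ.differentiable one_ne_zero x) hφ', ha, hb, sub_zero]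
  rw [h3, intervalIntegral.integral_add (hφ'.continuousOn_mul hac.continuousOn)
    (hφ'.const_mul _), h1, h2, intervalIntegral.integral_const_mul, h4, mul_zero, add_zero]

theorem intervalIntegrable_of_primitive {P : ℕ → ℝ → ℝ} {a b : ℝ} {n : ℕ} (hab : a ≤ b)
    (h0 : IntervalIntegrable (P 0) volume a b)
    (hP : ∀ k < n, ∀ x ∈ Icc a b, P (k + 1) x - P (k + 1) a = ∫ t in a..x, P k t) {k : ℕ}
    (hk : k ≤ n) : IntervalIntegrable (P k) volume a b := by
  induction k with
  | zero => exact h0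
  | succ k ih =>
    have ih := ih (by lia)
    have hc : ContinuousOn (fun x => (∫ t in a..x, P k t) + P (k + 1) a) (uIcc a b) :=
      (ih.absolutelyContinuousOnInterval_intervalIntegral left_mem_uIcc).continuousOn.add
        continuousOn_const
    refine (hc.congr fun x hx => ?_).intervalIntegrable
    rw [uIcc_of_le hab] at hx
    rw [← hP k (by lia) x hx]
    ring

theorem tsupport_iterate_deriv_subset (φ : ℝ → ℝ) (n : ℕ) :
    tsupport (deriv^[n] φ) ⊆ tsupport φ := by
  induction n with
  | zero => rfl
  | succ n ih =>
    rw [Function.iterate_succ_apply']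
    exact tsupport_deriv_subset.trans ih

theorem iterate_deriv_eq_zero {φ : ℝ → ℝ} {x : ℝ} (hx : x ∉ tsupport φ) (n : ℕ) :
    deriv^[n] φ x = 0 :=
  image_eq_zero_of_notMem_tsupport fun h => hx (tsupport_iterate_deriv_subset φ n h)

theorem integral_mul_iterate_deriv_of_primitive {P : ℕ → ℝ → ℝ} {φ : ℝ → ℝ} {a b : ℝ} {n : ℕ}
    (hab : a ≤ b) (h0 : IntervalIntegrable (P 0) volume a b)
    (hP : ∀ k < n, ∀ x ∈ Icc a b, P (k + 1) x - P (k + 1) a = ∫ t in a..x, P k t)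
    (hφ : ContDiff ℝ (⊤ : ℕ∞) φ) (ha : a ∉ tsupport φ) (hb : b ∉ tsupport φ) :
    ∫ x in a..b, P n x * deriv^[n] φ x = (-1) ^ n * ∫ x in a..b, P 0 x * φ x := by
  induction n with
  | zero => simp
  | succ n ih =>
    have hP' : ∀ k < n, ∀ x ∈ Icc a b, P (k + 1) x - P (k + 1) a = ∫ t in a..x, P k t :=
      fun k hk => hP k (by lia)
    simp only [Function.iterate_succ_apply']
    rw [integral_mul_deriv_of_primitive hab (intervalIntegrable_of_primitive hab h0 hP' le_rfl)
      (hP n (by lia)) ((hφ.iterate_deriv n).of_le (by exact_mod_cast le_top))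
      (iterate_deriv_eq_zero ha n) (iterate_deriv_eq_zero hb n), ih hP']
    ring

/-! ### Angular derivatives on the disk -/

theorem differentiableOn_angularDeriv_iterate {v : ℂ → ℂ}
    (hv : DifferentiableOn ℂ v (Metric.ball 0 1)) (n : ℕ) :
    DifferentiableOn ℂ (angularDeriv^[n] v) (Metric.ball 0 1) := by
  induction n with
  | zero => exact hv
  | succ n ih =>
    rw [Function.iterate_succ_apply']
    exact (by fun_prop : DifferentiableOn ℂ (fun z => Complex.I * z) _).mul
      (ih.deriv Metric.isOpen_ball)

theorem mul_circlePoint_mem_ball {r : ℝ} (hr : r ∈ Ico (0 : ℝ) 1) (θ : ℝ) :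
    (r : ℂ) * circlePoint θ ∈ Metric.ball (0 : ℂ) 1 := by
  rw [mem_ball_zero_iff, norm_mul, norm_circlePoint, mul_one, Complex.norm_real,
    Real.norm_of_nonneg hr.1]
  exact hr.2

/-- Since `d/dθ` of `z = r e^{iθ}` is `i z`, the angular derivative is differentiation in the angle.
-/
theorem hasDerivAt_re_mul_circlePoint {v : ℂ → ℂ} (hv : DifferentiableOn ℂ v (Metric.ball 0 1))
    {r : ℝ} (hr : r ∈ Ico (0 : ℝ) 1) (θ : ℝ) :
    HasDerivAt (fun θ => (v (r * circlePoint θ)).re) (angularDeriv v (r * circlePoint θ)).re θ := by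
  have h1 : HasDerivAt (fun θ : ℝ => (r : ℂ) * circlePoint θ)
      (r * (Complex.I * circlePoint θ)) θ := (hasDerivAt_circlePoint θ).const_mul _
  have h2 := (hv.differentiableAt
    (Metric.isOpen_ball.mem_nhds (mul_circlePoint_mem_ball hr θ))).hasDerivAt.scomp θ h1
  have h3 := Complex.reCLM.hasFDerivAt.comp_hasDerivAt θ h2
  have h4 : angularDeriv v (r * circlePoint θ) =
      (r * (Complex.I * circlePoint θ)) • deriv v (r * circlePoint θ) := by
    rw [angularDeriv, smul_eq_mul]
    ring
  rw [h4]
  exact h3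

theorem continuous_mul_circlePoint {v : ℂ → ℂ} (hv : ContinuousOn v (Metric.ball 0 1))
    {r : ℝ} (hr : r ∈ Ico (0 : ℝ) 1) : Continuous fun θ => v (r * circlePoint θ) :=
  hv.comp_continuous (continuous_const.mul continuous_circlePoint) (mul_circlePoint_mem_ball hr)

theorem integral_re_angularDeriv_iterate {v : ℂ → ℂ}
    (hv : DifferentiableOn ℂ v (Metric.ball 0 1)) {r : ℝ} (hr : r ∈ Ico (0 : ℝ) 1) {φ : ℝ → ℝ}
    {a b : ℝ} (hφ : ContDiff ℝ (⊤ : ℕ∞) φ) (ha : a ∉ tsupport φ) (hb : b ∉ tsupport φ) (n : ℕ) :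
    ∫ θ in a..b, (angularDeriv^[n] v (r * circlePoint θ)).re * φ θ =
      (-1) ^ n * ∫ θ in a..b, (v (r * circlePoint θ)).re * deriv^[n] φ θ := by
  -- Each step puts one more derivative on the test function, so the induction must allow `m`
  -- derivatives there already.
  suffices h : ∀ m, ∫ θ in a..b, (angularDeriv^[n] v (r * circlePoint θ)).re * deriv^[m] φ θ =
      (-1) ^ n * ∫ θ in a..b, (v (r * circlePoint θ)).re * deriv^[m + n] φ θ by
    simpa using h 0
  induction n with
  | zero => simp
  | succ n ih =>
    intro m
    have hvn := differentiableOn_angularDeriv_iterate hv n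
    have hm := hφ.iterate_deriv m
    have h1 := intervalIntegral.integral_mul_deriv_eq_deriv_mul (a := a) (b := b)
      (u := fun θ => (angularDeriv^[n] v (r * circlePoint θ)).re) (v := deriv^[m] φ)
      (v' := deriv^[m + 1] φ)
      (fun θ _ => hasDerivAt_re_mul_circlePoint hvn hr θ)
      (fun θ _ => by
        rw [Function.iterate_succ_apply']
        exact (hm.differentiable (by simp) θ).hasDerivAt)
      (Continuous.intervalIntegrable (Complex.continuous_re.comp
        (continuous_mul_circlePoint (by
          rw [← Function.iterate_succ_apply' angularDeriv]
          exact (differentiableOn_angularDeriv_iterate hv (n + 1)).continuousOn) hr)) _ _)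
      ((hφ.iterate_deriv (m + 1)).continuous.intervalIntegrable _ _)
    rw [ih, iterate_deriv_eq_zero ha, iterate_deriv_eq_zero hb, mul_zero, mul_zero, sub_zero,
      zero_sub] at h1
    simp only [Function.iterate_succ_apply' angularDeriv]
    rw [← neg_eq_iff_eq_neg.2 h1, pow_succ, show m + (n + 1) = m + 1 + n by ring]
    ring

/-! ### Boundary values -/

/-- The extension of `w` to the points of the closed disk at which it has a limit. -/
def boundaryExtension (w : ℂ → ℂ) : ℂ → ℂ := extendFrom (Metric.ball 0 1) w

theorem tendsto_boundaryExtension {w : ℂ → ℂ} {z : ℂ} (hz : z ∈ Metric.sphere (0 : ℂ) 1)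
    (h : z ∉ hardSingularities w) :
    Tendsto w (𝓝[Metric.ball 0 1] z) (𝓝 (boundaryExtension w z)) := by
  have : IsSoftAt w z := by
    by_contra h'
    exact h ⟨hz, h'⟩
  exact tendsto_extendFrom this

theorem exists_tendsto_of_notMem_hardSingularities {w : ℂ → ℂ}
    (hw : ContinuousOn w (Metric.ball 0 1)) {z : ℂ}
    (hz : z ∈ Metric.closedBall (0 : ℂ) 1 \ hardSingularities w) :
    ∃ l, Tendsto w (𝓝[Metric.ball 0 1] z) (𝓝 l) := by
  rcases (Metric.sphere_union_ball (x := (0 : ℂ)) (ε := 1)).symm ▸ hz.1 with h | h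
  · exact ⟨_, tendsto_boundaryExtension h hz.2⟩
  · exact ⟨_, hw z h⟩

theorem continuousOn_boundaryExtension {w : ℂ → ℂ} (hw : ContinuousOn w (Metric.ball 0 1)) :
    ContinuousOn (boundaryExtension w) (Metric.closedBall 0 1 \ hardSingularities w) := by
  refine continuousOn_extendFrom ?_ fun z hz => exists_tendsto_of_notMem_hardSingularities hw hz
  rw [closure_ball _ one_ne_zero]
  exact sdiff_subset

theorem boundaryExtension_eq {w : ℂ → ℂ} (hw : ContinuousOn w (Metric.ball 0 1)) {z : ℂ}
    (hz : z ∈ Metric.ball (0 : ℂ) 1) : boundaryExtension w z = w z :=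
  extendFrom_eq (subset_closure hz) (hw z hz)

/-- Continuity up to `r = 1` on a compact polar rectangle supplies the uniform bound for dominated
convergence as `r → 1`. -/
theorem continuousOn_boundaryExtension_polar {w : ℂ → ℂ} (hw : ContinuousOn w (Metric.ball 0 1))
    {a b : ℝ} (h : ∀ θ ∈ Icc a b, circlePoint θ ∉ hardSingularities w) :
    ContinuousOn (fun p : ℝ × ℝ => boundaryExtension w (p.1 * circlePoint p.2))
      (Icc 0 1 ×ˢ Icc a b) := by
  have := continuous_circlePoint
  refine (continuousOn_boundaryExtension hw).comp (by fun_prop) ?_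
  rintro ⟨r, θ⟩ ⟨⟨hr0, hr1⟩, hθ⟩
  have hn : ‖(r : ℂ) * circlePoint θ‖ = r := by
    rw [norm_mul, norm_circlePoint, mul_one, Complex.norm_real, Real.norm_of_nonneg hr0]
  refine ⟨by rwa [mem_closedBall_zero_iff, hn], fun hH => ?_⟩
  have h1 := hH.1
  rw [mem_sphere_zero_iff_norm, hn] at h1
  refine h θ hθ ?_
  simpa [h1] using hH

theorem tendsto_integral_re_mul {w : ℂ → ℂ} (hw : ContinuousOn w (Metric.ball 0 1))
    {a b : ℝ} (hab : a ≤ b) (h : ∀ θ ∈ Icc a b, circlePoint θ ∉ hardSingularities w)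
    {φ : ℝ → ℝ} (hφ : Continuous φ) :
    Tendsto (fun r : ℝ => ∫ θ in a..b, (w (r * circlePoint θ)).re * φ θ) (𝓝[<] 1)
      (𝓝 (∫ θ in a..b, (boundaryExtension w (circlePoint θ)).re * φ θ)) := by
  have hc := continuousOn_boundaryExtension_polar hw h
  obtain ⟨M, hM⟩ := (isCompact_Icc.prod isCompact_Icc).exists_bound_of_continuousOn hc
  have hIoo : ∀ᶠ r : ℝ in 𝓝[<] 1, r ∈ Ioo (0 : ℝ) 1 := Ioo_mem_nhdsLT one_pos
  refine intervalIntegral.tendsto_integral_filter_of_dominated_convergence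
    (fun θ => M * |φ θ|) ?_ ?_ ?_ ?_
  · filter_upwards [hIoo] with r hr
    exact ((Complex.continuous_re.comp (continuous_mul_circlePoint hw ⟨hr.1.le, hr.2⟩)).mul
      hφ).aestronglyMeasurable
  · filter_upwards [hIoo] with r hr
    refine ae_of_all _ fun θ hθ => ?_
    rw [uIoc_of_le hab] at hθ
    rw [norm_mul, Real.norm_eq_abs, Real.norm_eq_abs]
    gcongr
    rw [← boundaryExtension_eq hw (mul_circlePoint_mem_ball ⟨hr.1.le, hr.2⟩ θ)]
    exact (Complex.abs_re_le_norm _).trans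
      (hM (r, θ) ⟨⟨hr.1.le, hr.2.le⟩, Ioc_subset_Icc_self hθ⟩)
  · exact (continuous_const.mul hφ.abs).intervalIntegrable _ _
  · refine ae_of_all _ fun θ hθ => ?_
    rw [uIoc_of_le hab] at hθ
    refine Tendsto.mul_const _ ((Complex.continuous_re.tendsto _).comp ?_)
    refine (tendsto_boundaryExtension (circlePoint_mem_sphere θ)
      (h θ (Ioc_subset_Icc_self hθ))).comp ?_
    refine tendsto_nhdsWithin_iff.2 ⟨?_, ?_⟩
    · have : Continuous fun r : ℝ => (r : ℂ) * circlePoint θ := by fun_prop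
      have := (this.tendsto 1).mono_left (nhdsWithin_le_nhds (s := Iio 1))
      simpa using this
    · filter_upwards [hIoo] with r hr
      exact mul_circlePoint_mem_ball ⟨hr.1.le, hr.2⟩ θ

theorem integral_eq_of_support_subset {h : ℝ → ℝ} {a b a' b' : ℝ}
    (hs : Function.support h ⊆ Ioc a b) (hs' : Function.support h ⊆ Ioc a' b') :
    ∫ x in a..b, h x = ∫ x in a'..b', h x := by
  rw [intervalIntegral.integral_eq_integral_of_support_subset hs,
    intervalIntegral.integral_eq_integral_of_support_subset hs']

/-- Two evaluations of one limit as `r → 1`: directly, through the continuous extension, and after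
moving the `n` angular derivatives to `φ`, through weak convergence to `P n`. Keeping the arc
strictly inside `(0, 2π)` makes the differentiated test function and its derivative vanish at both
ends, as the Fourier argument requires. -/
theorem integral_boundaryExtension_mul_eq {w : ℂ → ℂ} {P : ℕ → ℝ → ℝ} {n : ℕ} {a b : ℝ}
    (ha : 0 < a) (hab : a ≤ b) (hb : b < 2 * Real.pi)
    (h0 : IntervalIntegrable (P 0) volume a b)
    (hP : ∀ k < n, ∀ x ∈ Icc a b, P (k + 1) x - P (k + 1) a = ∫ t in a..x, P k t)
    (hn : IntervalIntegrable (P n) volume 0 (2 * Real.pi))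
    (hw : EqOn w (angularDeriv^[n] (innerAnalytic (P n))) (Metric.ball 0 1))
    (hsoft : ∀ θ ∈ Icc a b, circlePoint θ ∉ hardSingularities w)
    {φ : ℝ → ℝ} (hφ : ContDiff ℝ (⊤ : ℕ∞) φ) (hφs : tsupport φ ⊆ Ioo a b) :
    ∫ θ in a..b, (boundaryExtension w (circlePoint θ)).re * φ θ = ∫ θ in a..b, P 0 θ * φ θ := by
  have hv := differentiableOn_innerAnalytic hn
  have hwc : ContinuousOn w (Metric.ball 0 1) :=
    (differentiableOn_angularDeriv_iterate hv n).continuousOn.congr hw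
  have haφ : a ∉ tsupport φ := fun h => lt_irrefl _ (hφs h).1
  have hbφ : b ∉ tsupport φ := fun h => lt_irrefl _ (hφs h).2
  have hsub : Ioo a b ⊆ Ioo 0 (2 * Real.pi) := Ioo_subset_Ioo ha.le hb.le
  set ψ := deriv^[n] φ with hψ
  have hψc : ContDiff ℝ (⊤ : ℕ∞) ψ := hφ.iterate_deriv n
  have hψs : tsupport ψ ⊆ Ioo a b := (tsupport_iterate_deriv_subset φ n).trans hφs
  have hz : ∀ x, x ∉ Ioo 0 (2 * Real.pi) → ψ x = 0 ∧ deriv ψ x = 0 := fun x hx => by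
    have h1 : x ∉ tsupport ψ := fun h => hx (hsub (hψs h))
    exact ⟨iterate_deriv_eq_zero h1 0, iterate_deriv_eq_zero h1 1⟩
  have hz0 := hz 0 (by simp)
  have hz1 := hz (2 * Real.pi) (by simp)
  have hlim := tendsto_integral_re_innerAnalytic_mul hn 
    (contDiff_infty.1 hψc 2)
    (hz0.1.trans hz1.1.symm) (hz0.2.trans hz1.2.symm)
  -- Weak convergence lives on the whole circle, the primitive relations only on the arc; the
  -- support of `ψ` lets the integrals pass from one to the other.
  have hchange : ∀ G : ℝ → ℝ,
      ∫ θ in (0 : ℝ)..(2 * Real.pi), G θ * ψ θ = ∫ θ in a..b, G θ * ψ θ := by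
    intro G
    have hs : Function.support (fun θ => G θ * ψ θ) ⊆ Ioo a b := fun x hx =>
      hψs (subset_tsupport _ (right_ne_zero_of_mul hx))
    exact integral_eq_of_support_subset ((hs.trans hsub).trans Ioo_subset_Ioc_self)
      (hs.trans Ioo_subset_Ioc_self)
  simp only [hchange] at hlim
  rw [integral_mul_iterate_deriv_of_primitive hab h0 hP hφ haφ hbφ] at hlim
  have hlim' := hlim.const_mul ((-1) ^ n)
  -- The signs from the two rounds of integration by parts cancel.
  rw [← mul_assoc, ← pow_add, Even.neg_one_pow ⟨n, rfl⟩, one_mul] at hlim'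
  refine tendsto_nhds_unique ((tendsto_integral_re_mul hwc hab hsoft hφ.continuous).congr' ?_) hlim'
  have hIoo : ∀ᶠ r : ℝ in 𝓝[<] 1, r ∈ Ioo (0 : ℝ) 1 := Ioo_mem_nhdsLT one_pos
  filter_upwards [hIoo] with r hr
  have hr' : r ∈ Ico (0 : ℝ) 1 := ⟨hr.1.le, hr.2⟩
  rw [← integral_re_angularDeriv_iterate hv hr' hφ haφ hbφ]
  refine intervalIntegral.integral_congr fun θ _ => ?_
  simp only [hw (mul_circlePoint_mem_ball hr' θ)]

theorem ae_boundaryExtension_re_eq {w : ℂ → ℂ} {P : ℕ → ℝ → ℝ} {n : ℕ} {a b : ℝ}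
    (ha : 0 < a) (hab : a ≤ b) (hb : b < 2 * Real.pi)
    (h0 : IntervalIntegrable (P 0) volume a b)
    (hP : ∀ k < n, ∀ x ∈ Icc a b, P (k + 1) x - P (k + 1) a = ∫ t in a..x, P k t)
    (hn : IntervalIntegrable (P n) volume 0 (2 * Real.pi))
    (hw : EqOn w (angularDeriv^[n] (innerAnalytic (P n))) (Metric.ball 0 1))
    (hsoft : ∀ θ ∈ Icc a b, circlePoint θ ∉ hardSingularities w) :
    ∀ᵐ θ : ℝ, θ ∈ Ioo a b → (boundaryExtension w (circlePoint θ)).re = P 0 θ := by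
  have hwc : ContinuousOn w (Metric.ball 0 1) :=
    (differentiableOn_angularDeriv_iterate
      (differentiableOn_innerAnalytic hn) n).continuousOn.congr hw
  have hc : ContinuousOn (fun θ => (boundaryExtension w (circlePoint θ)).re) (uIcc a b) := by
    rw [uIcc_of_le hab]
    refine Complex.continuous_re.comp_continuousOn ((continuousOn_boundaryExtension hwc).comp
      continuous_circlePoint.continuousOn fun θ hθ =>
        ⟨circlePoint_mem_closedBall θ, hsoft θ hθ⟩)
  have hint : IntervalIntegrable
      (fun θ => (boundaryExtension w (circlePoint θ)).re - P 0 θ) volume a b :=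
    hc.intervalIntegrable.sub h0
  have hloc : LocallyIntegrableOn
      (fun θ => (boundaryExtension w (circlePoint θ)).re - P 0 θ) (Ioo a b) :=
    (((intervalIntegrable_iff_integrableOn_Ioc_of_le hab).1 hint).mono_set
      Ioo_subset_Ioc_self).locallyIntegrableOn
  have key := isOpen_Ioo.ae_eq_zero_of_integral_contDiff_smul_eq_zero hloc fun φ hφ _ hφs => ?_
  · filter_upwards [key] with θ h hθ
    exact sub_eq_zero.1 (h hθ)
  · rw [← intervalIntegral.integral_eq_integral_of_support_subset (a := a) (b := b)]
    · have h1 := integral_boundaryExtension_mul_eq ha hab hb h0 hP hn hw hsoft hφ hφs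
      rw [← sub_eq_zero, ← intervalIntegral.integral_sub
        (hc.intervalIntegrable.mul_continuousOn hφ.continuous.continuousOn)
        (h0.mul_continuousOn hφ.continuous.continuousOn)] at h1
      rw [← h1]
      refine intervalIntegral.integral_congr fun θ _ => ?_
      simp only [smul_eq_mul]
      ring
    · exact fun x hx => Ioo_subset_Ioc_self (hφs (subset_tsupport _ (left_ne_zero_of_mul hx)))

theorem injOn_circlePoint : InjOn circlePoint (Ico 0 (2 * Real.pi)) := by
  intro s hs t ht h
  obtain ⟨n, hn⟩ := Complex.exp_eq_exp_iff_exists_int.1 h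
  have h1 : s = t + n * (2 * Real.pi) := by
    have h2 := congrArg Complex.im hn
    simpa using h2
  have h2 : |(n : ℝ)| < 1 := by
    rw [abs_lt]
    have := Real.two_pi_pos
    have h3 := hs.1
    have h4 := hs.2
    have h5 := ht.1
    have h6 := ht.2
    constructor <;> nlinarith
  have h3 : n = 0 := Int.abs_lt_one_iff.1 (by exact_mod_cast h2)
  simpa [h3] using h1

theorem volume_setOf_not_tendsto_eq_zero {A : Set ℂ} (hA : A.Finite) {g : ℝ → ℝ} {w : ℂ → ℂ}
    (hg : ∀ a b : ℝ, (∀ θ ∈ Icc a b, circlePoint θ ∉ A) → IntegrableOn g (Icc a b))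
    (hw : IsCorrespondingInnerAnalytic A g w) (hfin : (hardSingularities w).Finite) :
    volume {θ | θ ∈ Ico 0 (2 * Real.pi) ∧
      ¬ Tendsto (fun z => (w z).re) (𝓝[Metric.ball 0 1] circlePoint θ) (𝓝 (g θ))} = 0 := by
  obtain ⟨n, P, rfl, hP, hn, hwP⟩ := hw
  have hBfin : (A ∪ hardSingularities w).Finite := hA.union hfin
  set B := A ∪ hardSingularities w with hB
  set O : Set ℝ := Ioo 0 (2 * Real.pi) ∩ circlePoint ⁻¹' Bᶜ with hO
  have hOo : IsOpen O :=
    isOpen_Ioo.inter (hBfin.isClosed.isOpen_compl.preimage continuous_circlePoint)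
  have hnull : volume {θ ∈ O | (boundaryExtension w (circlePoint θ)).re ≠ P 0 θ} = 0 := by
    refine measure_null_of_locally_null _ fun x hx => ?_
    obtain ⟨δ, hδ, hball⟩ := Metric.isOpen_iff.1 hOo x hx.1
    have hI : Icc (x - δ / 2) (x + δ / 2) ⊆ O := fun y hy => hball (by
      rw [Metric.mem_ball, Real.dist_eq, abs_lt]
      constructor <;> linarith [hy.1, hy.2])
    have hab : x - δ / 2 ≤ x + δ / 2 := by linarith
    have hIA : ∀ θ ∈ Icc (x - δ / 2) (x + δ / 2), circlePoint θ ∉ A :=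
      fun θ hθ h => (hI hθ).2 (Or.inl h)
    have key := ae_boundaryExtension_re_eq (P := P) (n := n)
      (hI (left_mem_Icc.2 hab)).1.1 hab (hI (right_mem_Icc.2 hab)).1.2
      ((intervalIntegrable_iff_integrableOn_Ioc_of_le hab).2
        ((hg _ _ hIA).mono_set Ioc_subset_Icc_self))
      (fun k hk y hy => (hP k hk).2 _ _ hy.1 fun θ hθ => hIA θ ⟨hθ.1, hθ.2.trans hy.2⟩)
      hn hwP fun θ hθ h => (hI hθ).2 (Or.inr h)
    refine ⟨_, inter_mem_nhdsWithin _ (Ioo_mem_nhds (by linarith : x - δ / 2 < x)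
      (by linarith : x < x + δ / 2)), ?_⟩
    refine measure_mono_null ?_ (ae_iff.1 key)
    rintro θ ⟨hθ, hθI⟩ h
    exact hθ.2 (h hθI)
  have hfinite : (Ico 0 (2 * Real.pi) ∩ circlePoint ⁻¹' B).Finite :=
    Finite.of_injOn (f := circlePoint) (fun θ hθ => hθ.2)
      (injOn_circlePoint.mono inter_subset_left) hBfin
  -- The angle 0 is discarded separately because the arcs used above lie in the open interval `(0,
  -- 2π)`.
  refine measure_mono_null (t := {0} ∪ (Ico 0 (2 * Real.pi) ∩ circlePoint ⁻¹' B) ∪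
    {θ ∈ O | (boundaryExtension w (circlePoint θ)).re ≠ P 0 θ}) ?_
    (measure_union_null (measure_union_null (measure_singleton _) (hfinite.measure_zero _)) hnull)
  rintro θ ⟨hθ, hnt⟩
  by_contra hcon
  simp only [mem_union, not_or] at hcon
  obtain ⟨⟨h0, h1⟩, h2⟩ := hcon
  have hθB : circlePoint θ ∉ B := fun h => h1 ⟨hθ, h⟩
  have hθO : θ ∈ O := ⟨⟨lt_of_le_of_ne hθ.1 (Ne.symm h0), hθ.2⟩, hθB⟩
  have heq : (boundaryExtension w (circlePoint θ)).re = P 0 θ := by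
    by_contra h
    exact h2 ⟨hθO, h⟩
  refine hnt (heq ▸ (Complex.continuous_re.tendsto _).comp
    (tendsto_boundaryExtension (circlePoint_mem_sphere θ) fun h => hθB (Or.inr h)))

theorem IsCorrespondingInnerAnalytic.differentiableOn {A : Set ℂ} {g : ℝ → ℝ} {w : ℂ → ℂ}
    (hw : IsCorrespondingInnerAnalytic A g w) : DifferentiableOn ℂ w (Metric.ball 0 1) := by
  obtain ⟨n, P, -, -, hn, hwP⟩ := hw
  exact (differentiableOn_angularDeriv_iterate (differentiableOn_innerAnalytic hn) n).congr hwP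

end Dirichlet

end

/-! ### Transport of the solution from the disk to the interior of the curve -/

theorem theorem5
    (c : ℝ → ℂ) (L : ℝ) (hc : Dirichlet.IsSimpleClosedCurve c L)
    (γ : ℂ → ℂ) (hγ : Dirichlet.IsConformalMap γ (range c))
    (f : ℂ → ℝ) (E : Set ℂ) (hf : Dirichlet.IsLocallyIntegrableOff c f E)
    (w : ℂ → ℂ)
    (hw : Dirichlet.IsCorrespondingInnerAnalytic
      {z | z ∈ Metric.sphere (0 : ℂ) 1 ∧ γ z ∈ E}
      (fun θ => f (γ (Dirichlet.circlePoint θ))) w)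
    (hfin : (Dirichlet.hardSingularities w).Finite)
    (hdeg : ∀ ζ ∈ Dirichlet.hardSingularities w, ∃ m : ℕ, Dirichlet.HasDegreeOfHardness w ζ m) :
    ∃ u : ℂ → ℝ, Dirichlet.SolvesDirichlet c f u := by
  have hA : {z | z ∈ Metric.sphere (0 : ℂ) 1 ∧ γ z ∈ E}.Finite :=
    Finite.of_injOn (fun z hz => hz.2)
      (hγ.bijOn_circle.injOn.mono fun z hz => hz.1) hf.finite
  refine ⟨fun z => (w (Dirichlet.diskInverse γ z)).re, ?_, ?_⟩
  · have hd : DifferentiableOn ℂ (fun z => w (Dirichlet.diskInverse γ z))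
        (Dirichlet.curveInterior (range c)) :=
      hw.differentiableOn.comp hγ.differentiableOn_diskInverse hγ.mapsTo_diskInverse_interior
    intro z hz
    exact (hd.analyticAt ((Dirichlet.isOpen_curveInterior hγ.isClosed).mem_nhds hz)).harmonicAt_re
  · have hN := Dirichlet.volume_setOf_angle_mem_eq_zero hc hγ
      (Dirichlet.volume_setOf_not_tendsto_eq_zero hA (fun a b h =>
        Dirichlet.integrableOn_angle hc hγ hf isCompact_Icc fun θ hθ hE =>
          h θ hθ ⟨Dirichlet.circlePoint_mem_sphere θ, hE⟩) hw hfin)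
    rw [ae_iff]
    -- If convergence fails at `c s`, it fails for `w` at the corresponding angle, because the
    -- inverse of `γ` is continuous up to the curve. So `s` lies in the transferred null set.
    refine measure_mono_null (fun s hs => ?_) hN
    have hcs : c s ∈ range c := mem_range_self s
    obtain ⟨θ, hθ, hθs⟩ := Dirichlet.exists_circlePoint_eq (hγ.mapsTo_diskInverse_curve hcs)
    have hγθ : γ (Dirichlet.circlePoint θ) = c s := by
      rw [hθs, hγ.apply_diskInverse (Or.inl hcs)]
    refine ⟨θ, ⟨hθ, fun ht => hs ?_⟩, hγθ⟩
    rw [hγθ, hθs] at ht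
    refine ht.comp (tendsto_nhdsWithin_iff.2 ⟨?_, ?_⟩)
    · exact ((hγ.continuousOn_diskInverse (c s) (Or.inl hcs)).mono subset_union_right).tendsto
    · filter_upwards [self_mem_nhdsWithin] with z hz
      exact hγ.mapsTo_diskInverse_interior hz
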